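/- All graphs are finite and simple. A class of graphs is *proper minor-closed* if it is closed under taking minors and does not contain all graphs; it is *monotone* if it is closed under taking (not necessarily induced) subgraphs, and *summable* if the disjoint union of any two of its members is again a member. For $\varepsilon>0$ and a class $\mathcal P$, a graph $G\notin\mathcal P$ is *$\varepsilon$-far from $\mathcal P$* if every graph of $\mathcal P$ on the vertex set $V(G)$ differs from $G$ in at least $\varepsilon|E(G)|$ adjacencies. Fix a polynomial $q$ with coefficients in $\mathbb N$. Admissible instances are connected graphs $G$ whose vertices carry distinct identifiers in $\{1,\dots,q(|V(G)|)\}$. A *proof* for a graph $G$ is a map $\pi:V(G)\to\{0,1\}^*$. A *prover* assigns a proof to each graph with distinct identifiers; a *verifier* $\mathcal A$ assigns to each graph $G$ with distinct identifiers, each proof $\pi$ for $G$ and each vertex $v$ of $G$ a value $\mathcal A(G,\pi,v)\in\{0,1\}$. The verifier has *local horizon $s$* if always $\mathcal A(G,\pi,v)=\mathcal A(G[v,s],\pi[v,s],v)$, where $G[v,s]$ is the labelled subgraph of $G$ induced by the vertices at distance at most $s$ from $v$ and $\pi[v,s]$ is the restriction of $\pi$ to these vertices. An *$r$-round $\varepsilon$-approximate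 proof labelling scheme* for $\mathcal P$ is a pair (prover, verifier $\mathcal A$) such that * $\mathcal A$ has a local horizon at most $r$; * (completeness) for every admissible $G\in\mathcal P$ and the proof $\pi$ that the prover assigns to $G$, $\mathcal A(G,\pi,v)=1$ for all $v\in V(G)$; * (soundness) for every admissible $G$ that is $\varepsilon$-far from $\mathcal P$ and every proof $\pi'$ for $G$, $\mathcal A(G,\pi',v)=0$ for some $v\in V(G)$. It has *complexity at most $K$* if for every admissible $G\in\mathcal P$ each certificate assigned by the prover has at most $K$ bits. **Theorem.** Let $\varepsilon>0$, let $\mathcal G$ be a proper minor-closed class of graphs, and let $\mathcal P\subseteq\mathcal G$ be monotone and summable. Then there are constants $r\ge 0$ and $K\ge 0$ such that, for every polynomial $q$, $\mathcal P$ has an $r$-round $\varepsilon$-approximate proof labelling scheme of complexity at most $K$. (No bound on the maximum degree is assumed.) -/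

import Mathlib

/-- A class of finite simple graphs. Closure under isomorphism follows from each of the closure
conditions `IsProperMinorClosed` and `IsMonotone` below. -/
def GraphClass : Type 1 := ∀ (V : Type) [Finite V], SimpleGraph V → Prop

/-- `H` is a minor of `G`: the vertices of `H` can be mapped to pairwise disjoint connected
(in particular non-empty) vertex sets of `G` so that adjacent vertices of `H` are mapped to sets
joined by at least one edge of `G`. -/
def IsMinor {W V : Type} (H : SimpleGraph W) (G : SimpleGraph V) : Prop :=
  ∃ branch : W → Set V,
    (∀ w, (G.induce (branch w)).Connected) ∧
    (∀ w w', w ≠ w' → Disjoint (branch w) (branch w')) ∧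
    (∀ w w', H.Adj w w' → ∃ a ∈ branch w, ∃ b ∈ branch w', G.Adj a b)

namespace GraphClass

/-- Closed under minors, and not the class of all finite graphs. -/
def IsProperMinorClosed (C : GraphClass) : Prop :=
  (∀ (V W : Type) [Finite V] [Finite W] (G : SimpleGraph V) (H : SimpleGraph W),
    IsMinor H G → C V G → C W H) ∧
  ∃ (n : ℕ) (G : SimpleGraph (Fin n)), ¬ C (Fin n) G

/-- Closed under taking (not necessarily induced) subgraphs, up to isomorphism. -/
def IsMonotone (C : GraphClass) : Prop :=
  ∀ (V W : Type) [Finite V] [Finite W] (G : SimpleGraph V) (H : SimpleGraph W),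
    H.IsContained G → C V G → C W H

/-- Closed under disjoint union. -/
def IsSummable (C : GraphClass) : Prop :=
  ∀ (V W : Type) [Finite V] [Finite W] (G : SimpleGraph V) (H : SimpleGraph W),
    C V G → C W H → C (V ⊕ W) (G.sum H)

/-- `G` is `ε`-far from `C`: it is not in `C`, and every graph of `C` on the same vertex set
differs from `G` in at least `ε |E(G)|` adjacencies. If `ε > 0` and `G` has an edge, the first
condition follows from the second; it only matters for edgeless graphs, for which
`ε |E(G)| = 0`. -/
def IsFar (C : GraphClass) (ε : ℝ) {V : Type} [Finite V] (G : SimpleGraph V) : Prop :=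
  ¬ C V G ∧
  ∀ H : SimpleGraph V, C V H →
    ε * (G.edgeSet.ncard : ℝ) ≤ ((symmDiff G.edgeSet H.edgeSet).ncard : ℝ)

end GraphClass

/-- A finite graph whose vertices carry distinct identifiers in `ℕ`. As the identifiers are
distinct, each vertex is represented by its own identifier: the vertex set is a finite set of
natural numbers. In this way a verifier can depend on the identifiers, and only on them, and not
on some further naming of the vertices. -/
structure LabelledGraph where
  verts : Finset ℕ
  graph : SimpleGraph verts

namespace LabelledGraph

/-- The identifiers of an `n`-vertex graph lie in `{1, …, q(n)}`. -/
def IdsBounded (L : LabelledGraph) (q : Polynomial ℕ) : Prop :=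
  ∀ i ∈ L.verts, 1 ≤ i ∧ i ≤ q.eval L.verts.card

/-- A proof for a labelled graph: a binary word (certificate) for each vertex. -/
abbrev Proof (L : LabelledGraph) : Type := L.verts → List Bool

open scoped Classical in
/-- The set of vertices at distance at most `r` from `v` (`edist` is infinite between
different components). -/
noncomputable def ballVerts (L : LabelledGraph) (v : L.verts) (r : ℕ) : Finset ℕ :=
  L.verts.filter fun w => ∃ hw : w ∈ L.verts, L.graph.edist v ⟨w, hw⟩ ≤ (r : ℕ∞)

theorem ballVerts_subset (L : LabelledGraph) (v : L.verts) (r : ℕ) :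
    L.ballVerts v r ⊆ L.verts := by
  classical
  exact Finset.filter_subset _ _

theorem self_mem_ballVerts (L : LabelledGraph) (v : L.verts) (r : ℕ) :
    (v : ℕ) ∈ L.ballVerts v r := by
  classical
  exact Finset.mem_filter.2 ⟨v.2, v.2, by simp⟩

/-- The inclusion of the ball in the vertex set. -/
def ballIncl (L : LabelledGraph) (v : L.verts) (r : ℕ) (w : L.ballVerts v r) : L.verts :=
  ⟨w, L.ballVerts_subset v r w.2⟩

/-- `G[v,r]`: the labelled subgraph of `G` induced by the ball of radius `r` around `v`. -/
noncomputable def ball (L : LabelledGraph) (v : L.verts) (r : ℕ) : LabelledGraph where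
  verts := L.ballVerts v r
  graph := L.graph.comap (L.ballIncl v r)

/-- The vertex `v`, as a vertex of `G[v,r]`. -/
def ballCentre (L : LabelledGraph) (v : L.verts) (r : ℕ) : (L.ball v r).verts :=
  ⟨v, L.self_mem_ballVerts v r⟩

/-- `P[v,r]`: the restriction of the proof `P` to the ball of radius `r` around `v`. -/
def ballProof (L : LabelledGraph) (P : L.Proof) (v : L.verts) (r : ℕ) : (L.ball v r).Proof :=
  fun w => P (L.ballIncl v r w)

end LabelledGraph

/-- A verifier takes a labelled graph, a proof for it and one of its vertices, and accepts
(`true`) or rejects (`false`). -/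
abbrev Verifier : Type := ∀ L : LabelledGraph, L.Proof → L.verts → Bool

/-- A prover assigns a proof to each labelled graph (only its values on the graphs of the class
to be certified matter). -/
abbrev Prover : Type := ∀ L : LabelledGraph, L.Proof

/-- The verifier is local with horizon `r`: `A(G,P,v) = A(G[v,r],P[v,r],v)`. -/
def Verifier.HasHorizon (A : Verifier) (r : ℕ) : Prop :=
  ∀ (L : LabelledGraph) (P : L.Proof) (v : L.verts),
    A L P v = A (L.ball v r) (L.ballProof P v r) (L.ballCentre v r)

/-- The pair `(Pr, A)` is an `r`-round `ε`-approximate proof labelling scheme for the class `C`,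
on connected graphs whose identifiers are bounded by the polynomial `q`. -/
structure IsApproxPLS (C : GraphClass) (q : Polynomial ℕ) (ε : ℝ) (r : ℕ)
    (Pr : Prover) (A : Verifier) : Prop where
  round : ∃ s ≤ r, A.HasHorizon s
  completeness : ∀ L : LabelledGraph, L.graph.Connected → L.IdsBounded q →
    C L.verts L.graph → ∀ v, A L (Pr L) v = true
  soundness : ∀ L : LabelledGraph, L.graph.Connected → L.IdsBounded q →
    C.IsFar ε L.graph → ∀ P : L.Proof, ∃ v, A L P v = false

/-- For the graphs of the class `C`, the prover `Pr` uses certificates of at most `K` bits. -/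
def Prover.ComplexityAtMost (Pr : Prover) (C : GraphClass) (q : Polynomial ℕ) (K : ℕ) : Prop :=
  ∀ L : LabelledGraph, L.graph.Connected → L.IdsBounded q → C L.verts L.graph →
    ∀ v, (Pr L v).length ≤ K

/-- `C` has an `r`-round `ε`-approximate proof labelling scheme of complexity at most `K`, for
identifiers bounded by the polynomial `q`. -/
def GraphClass.HasApproxPLS (C : GraphClass) (q : Polynomial ℕ) (ε : ℝ) (r K : ℕ) : Prop :=
  ∃ (Pr : Prover) (A : Verifier), IsApproxPLS C q ε r Pr A ∧ Pr.ComplexityAtMost C q K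

namespace SimpleGraph

variable {V : Type*}

/-! ### Geodesics and connectivity by descent. -/

/-- A shortest path from `r` to `u`, parametrised by the distance to `r`. -/
theorem Reachable.exists_geodesic {H : SimpleGraph V} {r u : V} (h : H.Reachable r u) :
    ∃ p : ℕ → V, p (H.dist r u) = u ∧
      (∀ t ≤ H.dist r u, H.Reachable r (p t) ∧ H.dist r (p t) = t) ∧
      ∀ t < H.dist r u, H.Adj (p t) (p (t + 1)) := by
  obtain ⟨w, hw⟩ := h.exists_walk_length_eq_dist
  refine ⟨w.getVert, by rw [← hw]; exact w.getVert_length, fun t ht => ?_, fun t ht => ?_⟩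
  · refine ⟨(w.take t).reachable, le_antisymm ?_ ?_⟩
    · exact (dist_le (w.take t)).trans (by simp [Walk.take_length])
    · have h1 := (w.take t).reachable.dist_triangle_left u
      have h2 := dist_le (w.drop t)
      rw [Walk.drop_length, hw] at h2
      omega
  · exact w.adj_getVert_succ (by omega)

theorem Reachable.dist_le_dist_add_one {H : SimpleGraph V} {r u w : V} (h : H.Reachable r u)
    (ha : H.Adj u w) : H.dist r w ≤ H.dist r u + 1 := by
  have h1 := h.dist_triangle_left w
  rwa [dist_eq_one_iff_adj.2 ha] at h1

/-- Consecutive vertices `p s, …, p t` form a walk. -/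
theorem reachable_and_dist_le_of_adj_succ {H : SimpleGraph V} {p : ℕ → V} {s t : ℕ} (hst : s ≤ t)
    (h : ∀ i, s ≤ i → i < t → H.Adj (p i) (p (i + 1))) :
    H.Reachable (p s) (p t) ∧ H.dist (p s) (p t) ≤ t - s := by
  induction t, hst using Nat.le_induction with
  | base => simp
  | succ t hst ih =>
    obtain ⟨h1, h2⟩ := ih fun i hi hit => h i hi (by omega)
    have ha := h t hst (by omega)
    have := h1.dist_le_dist_add_one ha
    exact ⟨h1.trans ha.reachable, by omega⟩

/-- A set is connected if each of its vertices can be moved into a connected subset by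
steps inside the set that decrease some rank. -/
theorem connected_induce_of_descent {G : SimpleGraph V} {A B : Set V} (hAB : A ⊆ B)
    (hA : (G.induce A).Connected) (μ : V → ℕ)
    (h : ∀ u ∈ B, u ∉ A → ∃ w ∈ B, G.Adj u w ∧ μ w < μ u) : (G.induce B).Connected := by
  obtain ⟨a, ha⟩ := hA.nonempty
  have key : ∀ n, ∀ u, ∀ hu : u ∈ B, μ u ≤ n →
      (G.induce B).Reachable ⟨u, hu⟩ ⟨a, hAB ha⟩ := by
    have hin : ∀ u, ∀ hu : u ∈ A, (G.induce B).Reachable ⟨u, hAB hu⟩ ⟨a, hAB ha⟩ := fun u hu =>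
      (hA.preconnected ⟨u, hu⟩ ⟨a, ha⟩).map (G.induceHomOfLE hAB).toHom
    intro n
    induction n with
    | zero =>
      intro u hu hn
      by_cases huA : u ∈ A
      · exact hin u huA
      · obtain ⟨w, -, -, hlt⟩ := h u hu huA
        omega
    | succ n ih =>
      intro u hu hn
      by_cases huA : u ∈ A
      · exact hin u huA
      · obtain ⟨w, hw, ha, hlt⟩ := h u hu huA
        have hadj : (G.induce B).Adj ⟨u, hu⟩ ⟨w, hw⟩ := ha
        exact hadj.reachable.trans (ih w hw (by omega))
  have : Nonempty B := ⟨⟨a, hAB ha⟩⟩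
  exact ⟨fun u w => (key _ u.1 u.2 le_rfl).trans (key _ w.1 w.2 le_rfl).symm⟩

theorem connected_induce_singleton (G : SimpleGraph V) (r : V) :
    (G.induce ({r} : Set V)).Connected := by
  have : Nonempty ({r} : Set V) := ⟨⟨r, rfl⟩⟩
  refine ⟨fun u w => ?_⟩
  rw [Subsingleton.elim u w]

/-! ### Growing a complete minor one breadth-first layer at a time. -/

/-- Disjoint connected and pairwise adjacent branch sets `A j`, for `j < m`, in a component of
the subgraph `H` of `G`, with vertices `v j`, for `j < h`, that are pairwise at distance at least
`R` in `G`, such that `v j` lies in `A j` for `j < m` and has distance at least `ℓ` in `H` from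
all the other branch sets. -/
structure ScatteredModel (G H : SimpleGraph V) (ℓ R m : ℕ) {h : ℕ} (v : Fin h → V)
    (A : Fin h → Set V) : Prop where
  reachable : ∀ j k, H.Reachable (v j) (v k)
  far : ∀ j k, j ≠ k → R ≤ G.dist (v j) (v k)
  connected : ∀ j : Fin h, (j : ℕ) < m → (G.induce (A j)).Connected
  mem : ∀ j : Fin h, (j : ℕ) < m → v j ∈ A j
  reachable_branch : ∀ j : Fin h, (j : ℕ) < m → ∀ a ∈ A j, H.Reachable (v j) a
  separated : ∀ j k : Fin h, j ≠ k → (k : ℕ) < m → ∀ a ∈ A k, ℓ ≤ H.dist (v j) a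
  disjoint : ∀ j k : Fin h, j < k → (k : ℕ) < m → Disjoint (A j) (A k)
  adj : ∀ j k : Fin h, j < k → (k : ℕ) < m → ∃ a ∈ A j, ∃ b ∈ A k, G.Adj a b

/-- If the component of `H'` that contains a scattered model is a component of a layer of breadth
first search in `H`, then the branch sets can be extended towards the root, and a neighbourhood of
the root gives one more branch set. -/
theorem ScatteredModel.extend {G H H' : SimpleGraph V} {ℓ R m h θ : ℕ} {v : Fin h → V}
    {A : Fin h → Set V} (M : ScatteredModel G H' ℓ (R + 4 * ℓ) m v A) (hG : G.Connected)
    (hHG : H ≤ G) (hH'H : H' ≤ H) (hℓ : 0 < ℓ) (hR : 2 * ℓ ≤ R) (hh : 2 ≤ h)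
    (r : V) (hr : ∀ j, H.Reachable r (v j))
    (hlayer : ∀ j u, H'.Reachable (v j) u → θ ≤ H.dist r u ∧ H.dist r u < θ + ℓ)
    (hkeep : ∀ j u w, H'.Reachable (v j) u → H.Adj u w → θ ≤ H.dist r w →
      H.dist r w ≤ H.dist r u → H'.Adj u w) :
    ∃ v' A', ScatteredModel G H ℓ R (m + 1) (h := h) v' A' := by
  have hd : ∀ j, θ ≤ H.dist r (v j) ∧ H.dist r (v j) < θ + ℓ := fun j => hlayer j _ .rfl
  have hGle : ∀ {a b}, H.Reachable a b → G.dist a b ≤ H.dist a b := fun hab => hab.dist_anti hHG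
  have htri : ∀ a b c, G.dist a c ≤ G.dist a b + G.dist b c := fun a b c => hG.dist_triangle
  -- Two vertices closer than `θ + ℓ` to `r` are at distance at least `R + 4 * ℓ ≥ 6 * ℓ`, so the
  -- layer is far from the root; hence `θ - 2 * ℓ` and `θ - ℓ` are not truncated.
  have hθ : 2 * ℓ ≤ θ := by
    have h1 := M.far ⟨0, by omega⟩ ⟨1, by omega⟩ (by simp)
    have h2 := htri (v ⟨0, by omega⟩) r (v ⟨1, by omega⟩)
    have h3 := hGle (hr ⟨0, by omega⟩)
    have h4 := hGle (hr ⟨1, by omega⟩)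
    rw [G.dist_comm] at h3
    have := hd ⟨0, by omega⟩
    have := hd ⟨1, by omega⟩
    omega
  choose p hpv hpd hpa using fun j => (hr j).exists_geodesic
  have hpp : ∀ j s t, s ≤ t → t ≤ H.dist r (v j) →
      H.Reachable (p j s) (p j t) ∧ H.dist (p j s) (p j t) ≤ t - s := fun j s t hst ht =>
    reachable_and_dist_le_of_adj_succ hst fun i _ hit => hpa j i (by omega)
  have hpG : ∀ j t, t ≤ H.dist r (v j) → G.dist (v j) (p j t) ≤ H.dist r (v j) - t := by
    intro j t ht
    obtain ⟨h1, h2⟩ := hpp j t _ ht le_rfl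
    rw [hpv] at h1 h2
    rw [G.dist_comm]
    exact (hGle h1).trans h2
  -- A path loses less than `2 * ℓ` down to level `θ - ℓ` and less than `3 * ℓ` down to `θ - 2 * ℓ`.
  -- Out of at least `6 * ℓ` this leaves `ℓ`. In the case of a common vertex `s = t`; if this level
  -- is below `θ - ℓ`, both losses may approach `3 * ℓ`, which still contradicts `6 * ℓ`.
  have hcross : ∀ j k s t, j ≠ k → s ≤ H.dist r (v j) → t ≤ H.dist r (v k) → θ ≤ s + 2 * ℓ →
      θ ≤ t + 2 * ℓ → θ ≤ s + ℓ ∨ p j s = p k t → ℓ ≤ G.dist (p j s) (p k t) := by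
    intro j k s t hjk hs ht hs' ht' hor
    have h1 := M.far j k hjk
    have h2 := hpG j s hs
    have h3 := hpG k t ht
    have h4 := htri (v j) (p j s) (v k)
    have h5 := htri (p j s) (p k t) (v k)
    rw [dist_comm (u := p k t)] at h5
    have := hd j
    have := hd k
    rcases hor with hor | hor
    · omega
    · have h6 := (hpd j s hs).2
      have h7 := (hpd k t ht).2
      rw [hor] at h6
      have : G.dist (p j s) (p k t) = 0 := by simp [hor]
      omega
  have hcross' : ∀ j k s t, j ≠ k → s ≤ H.dist r (v j) → t ≤ H.dist r (v k) → θ ≤ s + 2 * ℓ →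
      θ ≤ t + 2 * ℓ → p j s ≠ p k t := by
    intro j k s t hjk hs ht hs' ht' he
    have h1 := hcross j k s t hjk hs ht hs' ht' (.inr he)
    have : G.dist (p j s) (p k t) = 0 := by simp [he]
    omega
  -- Inside the layer the geodesic to the root survives in `H'`.
  have hin : ∀ j t, t ≤ H.dist r (v j) → θ ≤ t →
      H'.Reachable (v j) (p j t) ∧ H'.dist (v j) (p j t) ≤ H.dist r (v j) - t := by
    intro j t htd
    induction htd using Nat.decreasingInduction with
    | self => intro _; rw [hpv]; simp
    | of_succ t htd ih =>
      intro ht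
      obtain ⟨h1, h2⟩ := ih (by omega)
      have ha : H'.Adj (p j (t + 1)) (p j t) := by
        refine hkeep j _ _ h1 (hpa j t htd).symm ?_ ?_
        · rw [(hpd j t (by omega)).2]; omega
        · rw [(hpd j t (by omega)).2, (hpd j (t + 1) (by omega)).2]; omega
      have := h1.dist_le_dist_add_one ha
      exact ⟨h1.trans ha.reachable, by omega⟩
  have hAd : ∀ j : Fin h, (j : ℕ) < m → ∀ a ∈ A j, H.Reachable r a ∧ θ ≤ H.dist r a := by
    intro j hj a ha
    have h1 := M.reachable_branch j hj a ha
    exact ⟨(hr j).trans (h1.mono hH'H), (hlayer j a h1).1⟩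
  -- A meeting point would lie in the layer, hence at distance less than `ℓ` from `v j` in `H'`,
  -- against `separated`.
  have hApath : ∀ j k : Fin h, j ≠ k → (k : ℕ) < m → ∀ t ≤ H.dist r (v j), p j t ∉ A k := by
    intro j k hjk hk t ht hmem
    have h1 := (hAd k hk _ hmem).2
    rw [(hpd j t ht).2] at h1
    have h2 := M.separated j k hjk hk _ hmem
    have h3 := (hin j t ht h1).2
    have := hd j
    omega
  have hball : (G.induce {u | H.Reachable r u ∧ H.dist r u ≤ θ - 2 * ℓ}).Connected := by
    refine connected_induce_of_descent (A := {r}) (by rintro _ rfl; simp)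
      (connected_induce_singleton G r) (H.dist r) ?_
    rintro u ⟨hu, hud⟩ hur
    have hpos := hu.pos_dist_of_ne (Ne.symm hur)
    obtain ⟨q, hq, hqd, hqa⟩ := hu.exists_geodesic
    have h1 := hqd (H.dist r u - 1) (by omega)
    have h2 := hqa (H.dist r u - 1) (by omega)
    rw [Nat.sub_add_cancel hpos, hq] at h2
    exact ⟨_, ⟨h1.1, by omega⟩, hHG h2.symm, by omega⟩
  -- Old sets grow down their geodesics to level `θ - 2 * ℓ + 1`, just above the ball around `r`.
  -- That ball becomes branch set `m`, with a tentacle up to its new terminal. All terminals move to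
  -- level `θ - ℓ`, which is `ℓ` away from both the layer and the ball.
  let A' : Fin h → Set V := fun j =>
    if (j : ℕ) < m then A j ∪ p j '' Set.Icc (θ - 2 * ℓ + 1) (H.dist r (v j))
    else {u | H.Reachable r u ∧ H.dist r u ≤ θ - 2 * ℓ} ∪ p j '' Set.Icc (θ - 2 * ℓ) (θ - ℓ)
  have hA'1 : ∀ j : Fin h, (j : ℕ) < m →
      A' j = A j ∪ p j '' Set.Icc (θ - 2 * ℓ + 1) (H.dist r (v j)) := fun j hj => if_pos hj
  have hA'2 : ∀ j : Fin h, (j : ℕ) = m → A' j =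
      {u | H.Reachable r u ∧ H.dist r u ≤ θ - 2 * ℓ} ∪ p j '' Set.Icc (θ - 2 * ℓ) (θ - ℓ) :=
    fun j hj => if_neg (by omega)
  have hcases : ∀ k : Fin h, (k : ℕ) < m + 1 → ∀ a ∈ A' k,
      (a ∈ A k ∧ (k : ℕ) < m) ∨ (H.Reachable r a ∧ H.dist r a ≤ θ - 2 * ℓ ∧ (k : ℕ) = m) ∨
      ∃ t, θ ≤ t + 2 * ℓ ∧ t ≤ H.dist r (v k) ∧ a = p k t ∧
        ((k : ℕ) < m → θ < t + 2 * ℓ) ∧ ((k : ℕ) = m → t ≤ θ - ℓ) := by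
    intro k hk a ha
    have := hd k
    rcases Nat.lt_succ_iff_lt_or_eq.1 hk with hkm | hkm
    · rw [hA'1 k hkm] at ha
      rcases ha with ha | ⟨t, ⟨ht1, ht2⟩, rfl⟩
      · exact .inl ⟨ha, hkm⟩
      · exact .inr (.inr ⟨t, by omega, ht2, rfl, by omega, by omega⟩)
    · rw [hA'2 k hkm] at ha
      rcases ha with ⟨ha1, ha2⟩ | ⟨t, ⟨ht1, ht2⟩, rfl⟩
      · exact .inr (.inl ⟨ha1, ha2, hkm⟩)
      · exact .inr (.inr ⟨t, by omega, by omega, rfl, by omega, by omega⟩)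
  have hv' : ∀ j, H.Reachable r (p j (θ - ℓ)) ∧ H.dist r (p j (θ - ℓ)) = θ - ℓ := fun j =>
    hpd j _ (by have := hd j; omega)
  refine ⟨fun j => p j (θ - ℓ), A', ?_, ?_, ?_, ?_, ?_, ?_, ?_, ?_⟩
  · exact fun j k => (hv' j).1.symm.trans (hv' k).1
  · intro j k hjk
    have h1 := M.far j k hjk
    have := hd j
    have := hd k
    have h2 := hpG j (θ - ℓ) (by omega)
    have h3 := hpG k (θ - ℓ) (by omega)
    have h4 := htri (v j) (p j (θ - ℓ)) (v k)
    have h5 := htri (p j (θ - ℓ)) (p k (θ - ℓ)) (v k)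
    rw [dist_comm (u := p k (θ - ℓ))] at h5
    omega
  · intro j hj
    have hdj := hd j
    rcases Nat.lt_succ_iff_lt_or_eq.1 hj with hjm | hjm
    · rw [hA'1 j hjm]
      refine connected_induce_of_descent Set.subset_union_left (M.connected j hjm)
        (fun u => H.dist r (v j) - H.dist r u) ?_
      rintro u (hu | ⟨t, ⟨ht1, ht2⟩, rfl⟩) huA
      · exact absurd hu huA
      · have hne : t ≠ H.dist r (v j) := by
          rintro rfl
          exact huA (by rw [hpv]; exact M.mem j hjm)
        refine ⟨p j (t + 1), .inr ⟨t + 1, ⟨by omega, by omega⟩, rfl⟩,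
          hHG (hpa j t (by omega)), ?_⟩
        rw [(hpd j t ht2).2, (hpd j (t + 1) (by omega)).2]
        omega
    · rw [hA'2 j hjm]
      refine connected_induce_of_descent Set.subset_union_left hball (H.dist r) ?_
      rintro u (hu | ⟨t, ⟨ht1, ht2⟩, rfl⟩) huA
      · exact absurd hu huA
      · have h1 := hpd j t (by omega)
        have hne : θ - 2 * ℓ < t := by
          by_contra hlt
          exact huA ⟨h1.1, by omega⟩
        have h2 := hpa j (t - 1) (by omega)
        rw [Nat.sub_add_cancel (by omega)] at h2
        refine ⟨p j (t - 1), .inr ⟨t - 1, ⟨by omega, by omega⟩, rfl⟩, hHG h2.symm, ?_⟩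
        rw [h1.2, (hpd j (t - 1) (by omega)).2]
        omega
  · intro j hj
    have hdj := hd j
    rcases Nat.lt_succ_iff_lt_or_eq.1 hj with hjm | hjm
    · rw [hA'1 j hjm]
      exact .inr ⟨_, ⟨by omega, by omega⟩, rfl⟩
    · rw [hA'2 j hjm]
      exact .inr ⟨_, ⟨by omega, by omega⟩, rfl⟩
  · intro j hj a ha
    refine (hv' j).1.symm.trans ?_
    rcases hcases j hj a ha with ⟨ha, hjm⟩ | ⟨ha, -⟩ | ⟨t, -, ht, rfl, -⟩
    · exact (hAd j hjm a ha).1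
    · exact ha
    · exact (hpd j t ht).1
  · intro j k hjk hk a ha
    have hdj := hd j
    have hvj := hv' j
    rcases hcases k hk a ha with ⟨ha, hkm⟩ | ⟨ha, had, -⟩ | ⟨t, ht1, ht2, rfl, -⟩
    · have h1 := (hAd k hkm a ha).2
      have h2 := hvj.1.dist_triangle_left a
      omega
    · have h2 := ha.dist_triangle_left (p j (θ - ℓ))
      rw [dist_comm (u := a)] at h2
      omega
    · refine (hcross j k (θ - ℓ) t hjk (by omega) ht2 (by omega) ht1 (.inl (by omega))).trans
        (hGle (hvj.1.symm.trans (hpd k t ht2).1))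
  · intro j k hjk hk
    have hjm : (j : ℕ) < m := by have : (j : ℕ) < k := hjk; omega
    rw [Set.disjoint_left]
    intro a haj hak
    rcases hcases j (by omega) a haj with ⟨hj1, -⟩ | ⟨-, -, hj1⟩ | ⟨s, hs1, hs2, rfl, hs3, -⟩
    · rcases hcases k hk a hak with ⟨hk1, hkm⟩ | ⟨-, hk1, -⟩ | ⟨t, ht1, ht2, rfl, ht3, ht4⟩
      · exact Set.disjoint_left.1 (M.disjoint j k hjk hkm) hj1 hk1
      · have := (hAd j hjm a hj1).2
        omega
      · exact hApath k j hjk.ne' hjm t ht2 hj1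
    · omega
    · have hs4 := hs3 hjm
      rcases hcases k hk _ hak with ⟨hk1, hkm⟩ | ⟨-, hk1, -⟩ | ⟨t, ht1, ht2, he, -⟩
      · exact hApath j k hjk.ne hkm s hs2 hk1
      · rw [(hpd j s hs2).2] at hk1
        omega
      · exact hcross' j k s t hjk.ne hs2 ht2 hs1 ht1 he
  · intro j k hjk hk
    have hjm : (j : ℕ) < m := by have : (j : ℕ) < k := hjk; omega
    rw [hA'1 j hjm]
    rcases Nat.lt_succ_iff_lt_or_eq.1 hk with hkm | hkm
    · obtain ⟨a, ha, b, hb, hab⟩ := M.adj j k hjk hkm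
      rw [hA'1 k hkm]
      exact ⟨a, .inl ha, b, .inl hb, hab⟩
    · have hdj := hd j
      rw [hA'2 k hkm]
      -- The next vertex down the geodesic of `j` lies in the ball.
      have h1 := hpd j (θ - 2 * ℓ) (by omega)
      exact ⟨_, .inr ⟨θ - 2 * ℓ + 1, ⟨le_rfl, by omega⟩, rfl⟩, p j (θ - 2 * ℓ),
        .inl ⟨h1.1, h1.2.le⟩, hHG (hpa j _ (by omega)).symm⟩

end SimpleGraph

/-! ### Chopping into layers: parities, counting of offsets, bounded components. -/

namespace SimpleGraph

variable {V : Type*}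

/-- The layer of a vertex: the distance to a root of its component, shifted by the offset `o`, in
units of `ℓ`. -/
noncomputable def layer (H : SimpleGraph V) (ℓ o : ℕ) (u : V) : ℕ :=
  (H.dist (H.connectedComponentMk u).out u + o) / ℓ

/-- Remove the edges between different layers. -/
noncomputable def chop (H : SimpleGraph V) (ℓ o : ℕ) : SimpleGraph V where
  Adj u w := H.Adj u w ∧ H.layer ℓ o u = H.layer ℓ o w
  symm := ⟨fun _ _ h => ⟨h.1.symm, h.2.symm⟩⟩
  loopless := ⟨fun _ h => h.1.ne rfl⟩

/-- Iterated chopping with layers of width `ℓ` and offsets `o 0, o 1, …`. -/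
noncomputable def iterChop (ℓ : ℕ) : (N : ℕ) → SimpleGraph V → (Fin N → Fin ℓ) → SimpleGraph V
  | 0, H, _ => H
  | N + 1, H, o => iterChop ℓ N (H.chop ℓ (o 0)) (Fin.tail o)

/-- The parities of the layers of a vertex in the iterated chopping. -/
noncomputable def iterChopColour (ℓ : ℕ) :
    (N : ℕ) → SimpleGraph V → (Fin N → Fin ℓ) → V → Fin N → Bool
  | 0, _, _, _ => fun i => i.elim0
  | N + 1, H, o, u => Fin.cons (α := fun _ => Bool) (decide (Even (H.layer ℓ (o 0) u)))
      (iterChopColour ℓ N (H.chop ℓ (o 0)) (Fin.tail o) u)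

theorem chop_le (H : SimpleGraph V) (ℓ o : ℕ) : H.chop ℓ o ≤ H := fun _ _ h => h.1

theorem reachable_componentRoot (H : SimpleGraph V) (u : V) :
    H.Reachable (H.connectedComponentMk u).out u :=
  ConnectedComponent.exact (Quot.out_eq _)

theorem componentRoot_eq {H : SimpleGraph V} {u w : V} (h : H.Reachable u w) :
    (H.connectedComponentMk w).out = (H.connectedComponentMk u).out := by
  rw [ConnectedComponent.sound h]

theorem layer_eq_of_reachable {H : SimpleGraph V} {u w : V} (h : H.Reachable u w) (ℓ o : ℕ) :
    H.layer ℓ o w = (H.dist (H.connectedComponentMk u).out w + o) / ℓ := by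
  rw [layer, componentRoot_eq h]

theorem layer_eq_of_reachable_chop {H : SimpleGraph V} {ℓ o : ℕ} {u w : V}
    (h : (H.chop ℓ o).Reachable u w) : H.layer ℓ o w = H.layer ℓ o u := by
  rw [reachable_iff_reflTransGen] at h
  induction h with
  | refl => rfl
  | tail _ hbc ih => rw [← hbc.2, ih]

theorem Adj.dist_componentRoot_le {H : SimpleGraph V} {u w : V} (h : H.Adj u w) :
    H.dist (H.connectedComponentMk u).out w ≤ H.dist (H.connectedComponentMk u).out u + 1 :=
  (H.reachable_componentRoot u).dist_le_dist_add_one h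

theorem Adj.layer_le {H : SimpleGraph V} {u w : V} (h : H.Adj u w) {ℓ : ℕ} (hℓ : 0 < ℓ) (o : ℕ) :
    H.layer ℓ o w ≤ H.layer ℓ o u + 1 := by
  rw [layer_eq_of_reachable h.reachable, layer, ← Nat.add_div_right _ hℓ]
  have := h.dist_componentRoot_le
  exact Nat.div_le_div_right (by omega)

/-- Adjacent vertices lie in equal or consecutive layers, so one bit per round suffices. -/
theorem Adj.chop_adj_iff {H : SimpleGraph V} {u w : V} (h : H.Adj u w) {ℓ : ℕ} (hℓ : 0 < ℓ)
    (o : ℕ) : (H.chop ℓ o).Adj u w ↔ (Even (H.layer ℓ o u) ↔ Even (H.layer ℓ o w)) := by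
  have h1 := h.layer_le hℓ o
  have h2 := h.symm.layer_le hℓ o
  refine ⟨fun h => by rw [h.2], fun he => ⟨h, ?_⟩⟩
  simp only [Nat.even_iff] at he
  omega

theorem iterChop_adj_iff {ℓ : ℕ} (hℓ : 0 < ℓ) (N : ℕ) (H : SimpleGraph V) (o : Fin N → Fin ℓ)
    (u w : V) : (iterChop ℓ N H o).Adj u w ↔
      H.Adj u w ∧ iterChopColour ℓ N H o u = iterChopColour ℓ N H o w := by
  induction N generalizing H with
  | zero => exact ⟨fun h => ⟨h, funext fun i => i.elim0⟩, fun h => h.1⟩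
  | succ N ih =>
    rw [iterChop, ih, iterChopColour, iterChopColour, Fin.cons_inj, decide_eq_decide]
    constructor
    · rintro ⟨h1, h2⟩
      exact ⟨h1.1, (h1.1.chop_adj_iff hℓ _).1 h1, h2⟩
    · rintro ⟨h1, h2, h3⟩
      exact ⟨(h1.chop_adj_iff hℓ _).2 h2, h3⟩

/-- For at most one offset modulo `ℓ`, two consecutive integers lie in different layers. -/
theorem card_offset_div_ne_le_one (ℓ a : ℕ) :
    (Finset.univ.filter fun o : Fin ℓ => (a + o) / ℓ ≠ (a + 1 + o) / ℓ).card ≤ 1 := by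
  rw [Finset.card_le_one]
  -- The quotient changes only at a multiple of `ℓ`, which fixes `o` modulo `ℓ`.
  have key : ∀ o : Fin ℓ, (a + o) / ℓ ≠ (a + 1 + o) / ℓ → (a + 1 + o) % ℓ = 0 := by
    intro o ho
    by_contra hne
    apply ho
    rw [show a + 1 + (o : ℕ) = a + o + 1 by omega] at hne ⊢
    rw [Nat.succ_div, if_neg (fun hd => hne (Nat.mod_eq_zero_of_dvd hd)), add_zero]
  intro o ho o' ho'
  have h1 := key o (Finset.mem_filter.1 ho).2
  have h2 := key o' (Finset.mem_filter.1 ho').2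
  have h3 : (o : ℕ) ≡ o' [MOD ℓ] := Nat.ModEq.add_left_cancel' (a + 1) (h1.trans h2.symm)
  exact Fin.ext (Nat.ModEq.eq_of_lt_of_lt h3 o.2 o'.2)

theorem card_offset_div_ne_le_one_of_le (ℓ : ℕ) {a b : ℕ} (h1 : b ≤ a + 1) (h2 : a ≤ b + 1) :
    (Finset.univ.filter fun o : Fin ℓ => (a + o) / ℓ ≠ (b + o) / ℓ).card ≤ 1 := by
  obtain rfl | rfl | rfl : b = a ∨ b = a + 1 ∨ a = b + 1 := by omega
  · simp
  · exact card_offset_div_ne_le_one ℓ a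
  · simpa only [ne_comm] using card_offset_div_ne_le_one ℓ b

theorem card_offset_layer_ne_le_one {H : SimpleGraph V} {u w : V} (h : H.Adj u w) (ℓ : ℕ) :
    (Finset.univ.filter fun o : Fin ℓ => H.layer ℓ o u ≠ H.layer ℓ o w).card ≤ 1 := by
  have h1 := h.dist_componentRoot_le
  have h2 := h.symm.dist_componentRoot_le
  rw [componentRoot_eq h.reachable] at h2
  have h3 := card_offset_div_ne_le_one_of_le ℓ h1 h2
  refine le_trans (Finset.card_le_card fun o ho => ?_) h3
  have h4 := (Finset.mem_filter.1 ho).2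
  rw [layer_eq_of_reachable h.reachable, layer] at h4
  exact Finset.mem_filter.2 ⟨Finset.mem_univ _, h4⟩

/-- Each edge is cut for few choices of the offsets. -/
theorem card_iterChopColour_ne_le (ℓ N : ℕ) {H : SimpleGraph V} {u w : V}
    (h : H.Adj u w) :
    (Finset.univ.filter fun o : Fin N → Fin ℓ =>
      iterChopColour ℓ N H o u ≠ iterChopColour ℓ N H o w).card * ℓ ≤ N * ℓ ^ N := by
  induction N generalizing H with
  | zero =>
    have : ∀ o : Fin 0 → Fin ℓ, iterChopColour ℓ 0 H o u = iterChopColour ℓ 0 H o w :=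
      fun o => funext fun i => i.elim0
    simp [this]
  | succ N ih =>
    rw [Finset.card_filter, ← (Fin.consEquiv fun _ : Fin (N + 1) => Fin ℓ).sum_comp,
      Fintype.sum_prod_type, Finset.sum_mul]
    have hterm : ∀ a : Fin ℓ,
        (∑ o : Fin N → Fin ℓ, if iterChopColour ℓ (N + 1) H (Fin.cons a o) u ≠
          iterChopColour ℓ (N + 1) H (Fin.cons a o) w then 1 else 0) * ℓ ≤
        N * ℓ ^ N + (if H.layer ℓ a u ≠ H.layer ℓ a w then 1 else 0) * ℓ ^ (N + 1) := by
      intro a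
      -- Either the edge survives the first round and induction applies to the chopped graph, or `a`
      -- is the single bad offset and all `ℓ ^ N` continuations are charged to it.
      by_cases ha : H.layer ℓ a u = H.layer ℓ a w
      · have := ih (H := H.chop ℓ a) ⟨h, ha⟩
        rw [Finset.card_filter] at this
        simpa [iterChopColour, Fin.tail_cons, ha] using this
      · have h1 : (∑ o : Fin N → Fin ℓ, if iterChopColour ℓ (N + 1) H (Fin.cons a o) u ≠
            iterChopColour ℓ (N + 1) H (Fin.cons a o) w then 1 else 0) ≤ ℓ ^ N := by
          rw [← Finset.card_filter]
          refine (Finset.card_le_univ _).trans (by simp)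
        rw [if_pos ha, one_mul, pow_succ]
        exact (Nat.mul_le_mul_right ℓ h1).trans (Nat.le_add_left _ _)
    refine (Finset.sum_le_sum fun a _ => hterm a).trans ?_
    rw [Finset.sum_add_distrib, ← Finset.sum_mul _ _ (ℓ ^ (N + 1)), ← Finset.card_filter]
    have h1 := Nat.mul_le_mul_right (ℓ ^ (N + 1)) (card_offset_layer_ne_le_one h ℓ)
    refine (Nat.add_le_add_left h1 _).trans (le_of_eq ?_)
    simp
    ring

/-- A component of the chopped graph stays in one breadth-first layer, as `extend` requires. -/
theorem ScatteredModel.of_chop {G H : SimpleGraph V} {ℓ o R m h : ℕ} {v : Fin h → V}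
    {A : Fin h → Set V} (M : ScatteredModel G (H.chop ℓ o) ℓ (R + 4 * ℓ) m v A)
    (hG : G.Connected) (hHG : H ≤ G) (hℓ : 0 < ℓ) (hR : 2 * ℓ ≤ R) (hh : 2 ≤ h) :
    ∃ v' A', ScatteredModel G H ℓ R (m + 1) (h := h) v' A' := by
  have hle := H.chop_le ℓ o
  let j₀ : Fin h := ⟨0, by omega⟩
  have hreach : ∀ j u, (H.chop ℓ o).Reachable (v j) u → (H.chop ℓ o).Reachable (v j₀) u :=
    fun j u hu => (M.reachable j₀ j).trans hu
  have hl : ∀ u, (H.chop ℓ o).Reachable (v j₀) u →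
      (H.dist (H.connectedComponentMk (v j₀)).out u + o) / ℓ = H.layer ℓ o (v j₀) := by
    intro u hu
    rw [← layer_eq_of_reachable_chop hu, layer_eq_of_reachable (hu.mono hle)]
  -- The layer starts at this distance from the root; truncation to `0` gives the correct start for
  -- an initial layer shortened by the offset.
  refine M.extend (θ := H.layer ℓ o (v j₀) * ℓ - o) hG hHG hle hℓ hR hh
    (H.connectedComponentMk (v j₀)).out
    (fun j => (H.reachable_componentRoot _).trans ((M.reachable j₀ j).mono hle)) ?_ ?_
  · intro j u hu
    have h1 := hl u (hreach j u hu)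
    rw [Nat.div_eq_iff hℓ] at h1
    omega
  · intro j u w hu huw hw1 hw2
    have h1 := hl u (hreach j u hu)
    have hru := (hreach j u hu).mono hle
    refine ⟨huw, ?_⟩
    rw [layer_eq_of_reachable hru, layer_eq_of_reachable (hru.trans huw.reachable), h1]
    rw [Nat.div_eq_iff hℓ] at h1
    symm
    rw [Nat.div_eq_iff hℓ]
    omega

theorem ScatteredModel.of_iterChop {G H : SimpleGraph V} {ℓ N R m h : ℕ} {o : Fin N → Fin ℓ}
    {v : Fin h → V} {A : Fin h → Set V}
    (M : ScatteredModel G (iterChop ℓ N H o) ℓ (R + 4 * ℓ * N) m v A)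
    (hG : G.Connected) (hHG : H ≤ G) (hℓ : 0 < ℓ) (hR : 2 * ℓ ≤ R) (hh : 2 ≤ h) :
    ∃ v' A', ScatteredModel G H ℓ R (m + N) (h := h) v' A' := by
  induction N generalizing H R with
  | zero => exact ⟨v, A, M⟩
  | succ N ih =>
    rw [show R + 4 * ℓ * (N + 1) = R + 4 * ℓ + 4 * ℓ * N by ring] at M
    obtain ⟨v', A', M'⟩ := ih M ((H.chop_le ℓ _).trans hHG) (by omega)
    exact M'.of_chop hG hHG hℓ hR hh

theorem iterChop_le (ℓ N : ℕ) (H : SimpleGraph V) (o : Fin N → Fin ℓ) : iterChop ℓ N H o ≤ H := by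
  induction N generalizing H with
  | zero => exact le_rfl
  | succ N ih => exact (ih _ _).trans (chop_le _ _ _)

/-- A discrete intermediate value theorem: along a walk in `H` the distance in `G` grows by at most
one per step. -/
theorem Reachable.exists_dist_eq {G H : SimpleGraph V} (hG : G.Connected) (hHG : H ≤ G) {u w : V}
    (h : H.Reachable u w) {k : ℕ} (hk : k ≤ G.dist u w) :
    ∃ x, H.Reachable u x ∧ G.dist u x = k := by
  rw [reachable_iff_reflTransGen] at h
  induction h with
  | refl => exact ⟨u, .rfl, by rw [dist_self] at *; omega⟩
  | @tail b c hub hbc ih =>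
    by_cases hkb : k ≤ G.dist u b
    · exact ih hkb
    · have h1 := (hG u b).dist_le_dist_add_one (hHG hbc)
      exact ⟨c, (reachable_iff_reflTransGen _ _).2 (hub.tail hbc), by omega⟩

/-- **Klein–Plotkin–Rao**: if `G` has no complete minor on `h` vertices, then after chopping `h`
times with width `ℓ`, the components have bounded diameter in the metric of `G`. -/
theorem dist_lt_of_reachable_iterChop {V : Type} {G : SimpleGraph V} (hG : G.Connected) {h : ℕ}
    (hh : 2 ≤ h) (hminor : ¬ IsMinor (⊤ : SimpleGraph (Fin h)) G) {ℓ : ℕ} (hℓ : 0 < ℓ)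
    (o : Fin h → Fin ℓ) {u w : V} (huw : (iterChop ℓ h G o).Reachable u w) :
    G.dist u w < h * (2 * ℓ + 4 * ℓ * h) := by
  by_contra! hd
  apply hminor
  -- Each of the `h` rounds costs `4 * ℓ` of the spacing, and `2 * ℓ` must remain.
  set R := 2 * ℓ + 4 * ℓ * h with hRdef
  choose x hx hxd using fun i : Fin h => huw.exists_dist_eq hG (iterChop_le ℓ h G o)
    (k := i * R) ((Nat.mul_le_mul_right R i.2.le).trans hd)
  have hfar : ∀ j k : Fin h, j < k → R ≤ G.dist (x j) (x k) := by
    intro j k hjk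
    have h1 := hG.dist_triangle (u := u) (v := x j) (w := x k)
    rw [hxd, hxd] at h1
    have h2 : ((j : ℕ) + 1) * R ≤ k * R := Nat.mul_le_mul_right R hjk
    rw [add_mul, one_mul] at h2
    omega
  -- No branch set exists yet; each undone chop supplies one, giving `h` in the end.
  have M : ScatteredModel G (iterChop ℓ h G o) ℓ (2 * ℓ + 4 * ℓ * h) 0 x fun _ => ∅ :=
    { reachable := fun j k => (hx j).symm.trans (hx k)
      far := fun j k hjk => by
        rcases lt_or_gt_of_ne hjk with hlt | hlt
        · exact hfar j k hlt
        · rw [dist_comm]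
          exact hfar k j hlt
      connected := fun j hj => absurd hj (Nat.not_lt_zero _)
      mem := fun j hj => absurd hj (Nat.not_lt_zero _)
      reachable_branch := fun j hj => absurd hj (Nat.not_lt_zero _)
      separated := fun j k _ hk => absurd hk (Nat.not_lt_zero _)
      disjoint := fun j k _ hk => absurd hk (Nat.not_lt_zero _)
      adj := fun j k _ hk => absurd hk (Nat.not_lt_zero _) }
  obtain ⟨v', A', M'⟩ := M.of_iterChop hG le_rfl hℓ le_rfl hh
  rw [zero_add] at M'
  refine ⟨A', fun j => M'.connected j j.2, fun j k hjk => ?_, fun j k hjk => ?_⟩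
  · rcases lt_or_gt_of_ne hjk with hlt | hlt
    · exact M'.disjoint j k hlt k.2
    · exact (M'.disjoint k j hlt j.2).symm
  · rcases lt_or_gt_of_ne hjk.ne with hlt | hlt
    · exact M'.adj j k hlt k.2
    · obtain ⟨a, ha, b, hb, hab⟩ := M'.adj k j hlt j.2
      exact ⟨b, hb, a, ha, hab.symm⟩

end SimpleGraph

namespace SimpleGraph

/-! ### Padded colourings and averaging. -/

/-- The spanning subgraph formed by the edges whose ends have the same colour. -/
def monochromatic {V C : Type*} (G : SimpleGraph V) (c : V → C) : SimpleGraph V where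
  Adj u w := G.Adj u w ∧ c u = c w
  symm := ⟨fun _ _ h => ⟨h.1.symm, h.2.symm⟩⟩
  loopless := ⟨fun _ h => h.1.ne rfl⟩

theorem monochromatic_le {V C : Type*} (G : SimpleGraph V) (c : V → C) :
    G.monochromatic c ≤ G := fun _ _ h => h.1

/-- Connected graphs without a complete minor on `h` vertices have families of vertex colourings,
of constant size and with constantly many colours, such that each edge is bichromatic in at most a
fraction `ε` of the colourings and all monochromatic components have bounded diameter in `G`. -/
theorem exists_padded_colouring {h : ℕ} (hh : 2 ≤ h) {ε : ℝ} (hε : 0 < ε) :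
    ∃ (I C : Type) (_ : Finite I) (_ : Nonempty I) (_ : Finite C) (_ : Nonempty C) (D : ℕ),
      ∀ (V : Type) (G : SimpleGraph V), G.Connected → ¬ IsMinor (⊤ : SimpleGraph (Fin h)) G →
        ∃ c : I → V → C,
          (∀ u w, G.Adj u w → ({i | c i u ≠ c i w}.ncard : ℝ) < ε * Nat.card I) ∧
          ∀ i u w, (G.monochromatic (c i)).Reachable u w → G.dist u w ≤ D := by
  obtain ⟨ℓ, hℓ⟩ := exists_nat_gt (h / ε)
  have hℓ0 : (0 : ℝ) < ℓ := lt_of_le_of_lt (by positivity) hℓ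
  have hℓ1 : 0 < ℓ := by exact_mod_cast hℓ0
  refine ⟨Fin h → Fin ℓ, Fin h → Bool, inferInstance, ⟨fun _ => ⟨0, hℓ1⟩⟩, inferInstance,
    inferInstance, h * (2 * ℓ + 4 * ℓ * h), fun V G hG hminor => ⟨iterChopColour ℓ h G, ?_, ?_⟩⟩
  · intro u w huw
    have h1 := card_iterChopColour_ne_le ℓ h huw
    rw [Set.ncard_eq_toFinset_card', Set.toFinset_ofPred]
    rw [div_lt_iff₀ hε] at hℓ
    have h2 : ((Finset.univ.filter fun o : Fin h → Fin ℓ =>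
      iterChopColour ℓ h G o u ≠ iterChopColour ℓ h G o w).card : ℝ) * ℓ ≤ h * ℓ ^ h := by
      exact_mod_cast h1
    have h3 : (0 : ℝ) < ℓ ^ h := by positivity
    simp only [Nat.card_eq_fintype_card, Fintype.card_fun, Fintype.card_fin, Nat.cast_pow]
    nlinarith
  · intro o u w huw
    refine (dist_lt_of_reachable_iterChop hG hh hminor hℓ1 o (huw.mono ?_)).le
    exact fun a b hab => (iterChop_adj_iff hℓ1 h G o a b).2 hab

/-- If each edge is bichromatic in less than a fraction `ε` of the colourings, then in one of the
colourings less than a fraction `ε` of the edges is bichromatic. -/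
theorem exists_ncard_symmDiff_monochromatic_lt {V I C : Type*} [Finite V] [Finite I]
    {G : SimpleGraph V} (hG : G.edgeSet.Nonempty) (c : I → V → C) {ε : ℝ}
    (hc : ∀ u w, G.Adj u w → ({i | c i u ≠ c i w}.ncard : ℝ) < ε * Nat.card I) :
    ∃ i, ((symmDiff G.edgeSet (G.monochromatic (c i)).edgeSet).ncard : ℝ) <
      ε * G.edgeSet.ncard := by
  classical
  have := Fintype.ofFinite V
  have := Fintype.ofFinite I
  by_contra! hge
  let E : Finset (Sym2 V) := G.edgeSet.toFinset
  have hdiff : ∀ i, symmDiff G.edgeSet (G.monochromatic (c i)).edgeSet =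
      ((E.filter fun e => e ∉ (G.monochromatic (c i)).edgeSet : Finset (Sym2 V)) :
        Set (Sym2 V)) := by
    intro i
    rw [Set.symmDiff_def, Set.sdiff_eq_empty.2 (edgeSet_mono (G.monochromatic_le (c i)))]
    ext e
    simp [E]
  have hEcard : G.edgeSet.ncard = E.card := Set.ncard_eq_toFinset_card' _
  have hI : ∀ e ∈ E, ((Finset.univ.filter fun i => e ∉ (G.monochromatic (c i)).edgeSet).card : ℝ)
      < ε * Fintype.card I := by
    intro e he
    induction e using Sym2.ind with
    | _ u w =>
      have huw : G.Adj u w := by simpa [E] using he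
      have h1 := hc u w huw
      rw [Set.ncard_eq_toFinset_card', Set.toFinset_ofPred, Nat.card_eq_fintype_card] at h1
      simpa [monochromatic, huw] using h1
  have hcount := Finset.sum_card_bipartiteAbove_eq_sum_card_bipartiteBelow
    (s := (Finset.univ : Finset I)) (t := E) fun i e => e ∉ (G.monochromatic (c i)).edgeSet
  have h1 : ∑ _i : I, ε * (E.card : ℝ) ≤
      ∑ i : I, ((E.filter fun e => e ∉ (G.monochromatic (c i)).edgeSet).card : ℝ) := by
    refine Finset.sum_le_sum fun i _ => ?_
    have := hge i
    rwa [hdiff, Set.ncard_coe_finset, hEcard] at this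
  -- Strictness needs an edge to sum over.
  have h2 : ∑ e ∈ E,
      ((Finset.univ.filter fun i => e ∉ (G.monochromatic (c i)).edgeSet).card : ℝ) <
      ∑ _e ∈ E, ε * (Fintype.card I : ℝ) :=
    Finset.sum_lt_sum_of_nonempty (Set.toFinset_nonempty.2 hG) hI
  have h3 : ∑ i : I, ((E.filter fun e => e ∉ (G.monochromatic (c i)).edgeSet).card : ℝ) =
      ∑ e ∈ E, ((Finset.univ.filter fun i => e ∉ (G.monochromatic (c i)).edgeSet).card : ℝ) := by
    exact_mod_cast hcount
  rw [Finset.sum_const, nsmul_eq_mul] at h1 h2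
  rw [h3, Finset.card_univ] at h1
  linarith

end SimpleGraph

/-! ### Excluded complete minors and assembly from components. -/

/-- A minor-closed class that does not contain all graphs excludes a complete minor. -/
theorem GraphClass.IsProperMinorClosed.exists_not_isMinor_top {C : GraphClass}
    (hC : C.IsProperMinorClosed) : ∃ h, 2 ≤ h ∧ ∀ (V : Type) [Finite V] (G : SimpleGraph V),
      C V G → ¬ IsMinor (⊤ : SimpleGraph (Fin h)) G := by
  obtain ⟨hclosed, n, F, hF⟩ := hC
  -- The summand `2` only secures `2 ≤ h`; the excluded graph `F` is a minor of any graph with a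
  -- `K_n` minor.
  refine ⟨n + 2, by omega, fun V _ G hG => ?_⟩
  rintro ⟨b, hb1, hb2, hb3⟩
  refine hF (hclosed V (Fin n) G F ⟨fun i => b (i.castAdd 2), fun i => hb1 _, fun i j hij => ?_,
    fun i j hij => ?_⟩ hG)
  · exact hb2 _ _ fun he => hij (Fin.castAdd_injective n 2 he)
  · exact hb3 _ _ fun he => hij.ne (Fin.castAdd_injective n 2 he)

/-- A monotone and summable class contains each nonempty graph all of whose components it
contains. -/
theorem GraphClass.of_connectedComponents {C : GraphClass} (hmono : C.IsMonotone)
    (hsum : C.IsSummable) {V : Type} [Finite V] [Nonempty V] {G : SimpleGraph V}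
    (h : ∀ K : G.ConnectedComponent, C K.supp (G.induce K.supp)) : C V G := by
  classical
  have key : ∀ s : Finset G.ConnectedComponent,
      C {v | G.connectedComponentMk v ∈ s} (G.induce {v | G.connectedComponentMk v ∈ s}) := by
    intro s
    induction s using Finset.induction_on with
    | empty =>
      -- The empty class is monotone and summable, so the empty graph must come from an actual
      -- component.
      obtain ⟨v⟩ := ‹Nonempty V›
      refine hmono _ _ _ _ ⟨⟨⟨fun w => absurd w.2 (by simp), fun {w} => absurd w.2 (by simp)⟩,
        fun w => absurd w.2 (by simp)⟩⟩ (h (G.connectedComponentMk v))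
    | insert K s _ ih =>
      let f : {v | G.connectedComponentMk v ∈ insert K s} →
          K.supp ⊕ {v | G.connectedComponentMk v ∈ s} := fun v =>
        if hv : G.connectedComponentMk v.1 = K then .inl ⟨v.1, hv⟩
        else .inr ⟨v.1, (Finset.mem_insert.1 v.2).resolve_left hv⟩
      refine hmono _ _ _ _ ⟨⟨⟨f, ?_⟩, ?_⟩⟩ (hsum _ _ _ _ (h K) ih)
      · rintro ⟨v, hv⟩ ⟨w, hw⟩ (hvw : G.Adj v w)
        have heq : G.connectedComponentMk v = G.connectedComponentMk w :=
          SimpleGraph.ConnectedComponent.sound hvw.reachable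
        by_cases hvK : G.connectedComponentMk w = K
        · simpa [f, heq, hvK] using hvw
        · simpa [f, heq, hvK] using hvw
      · rintro ⟨v, hv⟩ ⟨w, hw⟩ hvw
        simp only [RelHom.coeFn_mk, f] at hvw
        split_ifs at hvw
        · have h1 := congrArg Subtype.val (Sum.inl.inj hvw)
          exact Subtype.ext h1
        · have h1 := congrArg Subtype.val (Sum.inr.inj hvw)
          exact Subtype.ext h1
  have := Fintype.ofFinite G.ConnectedComponent
  refine hmono _ _ _ _ ⟨⟨⟨fun v => ⟨v, Finset.mem_univ _⟩, id⟩, ?_⟩⟩ (key Finset.univ)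
  exact fun v w hvw => congrArg Subtype.val hvw

/-! ### Balls and their distances. -/

namespace LabelledGraph

theorem mem_ballVerts {L : LabelledGraph} {v : L.verts} {r : ℕ} (w : L.verts) :
    (w : ℕ) ∈ L.ballVerts v r ↔ L.graph.edist v w ≤ r := by
  classical
  simp [ballVerts]

/-- Distances to the centre that are at most the radius are the same in the ball. -/
theorem edist_ballCentre_le (L : LabelledGraph) (v : L.verts) {r s : ℕ} (hsr : s ≤ r)
    (w : (L.ball v r).verts) (hw : L.graph.edist v (L.ballIncl v r w) ≤ s) :
    (L.ball v r).graph.edist (L.ballCentre v r) w ≤ s := by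
  obtain ⟨p, hp⟩ := SimpleGraph.exists_walk_of_edist_ne_top
    (ne_top_of_le_ne_top (ENat.natCast_ne_top s) hw)
  have hps : p.length ≤ s := by rw [← hp] at hw; exact_mod_cast hw
  have hmem : ∀ t ≤ s, (p.getVert t : ℕ) ∈ L.ballVerts v r := fun t ht => by
    rw [mem_ballVerts]
    refine (SimpleGraph.edist_le (p.take t)).trans ?_
    rw [SimpleGraph.Walk.take_length]
    exact_mod_cast (min_le_left _ _).trans (ht.trans hsr)
  have key : ∀ t, ∀ ht : t ≤ p.length, (L.ball v r).graph.edist (L.ballCentre v r)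
      ⟨p.getVert t, hmem t (ht.trans hps)⟩ ≤ t := by
    intro t
    induction t with
    | zero =>
      intro _
      have heq : (⟨p.getVert 0, hmem 0 (Nat.zero_le s)⟩ : (L.ball v r).verts) =
          L.ballCentre v r := by
        have h1 : _ = ((_ : L.verts) : ℕ) := congrArg Subtype.val p.getVert_zero
        exact Subtype.ext h1
      rw [heq]
      simp
    | succ t ih =>
      intro ht
      have hadj : (L.ball v r).graph.Adj ⟨p.getVert t, hmem t (by omega)⟩
          ⟨p.getVert (t + 1), hmem _ (ht.trans hps)⟩ := p.adj_getVert_succ (by omega)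
      refine (SimpleGraph.edist_triangle (v := ⟨p.getVert t, hmem t (by omega)⟩)).trans ?_
      rw [Nat.cast_succ]
      exact add_le_add (ih (by omega)) (SimpleGraph.edist_eq_one_iff_adj.2 hadj).le
  have hlast := key p.length le_rfl
  have heq : (⟨p.getVert p.length, hmem _ hps⟩ : (L.ball v r).verts) = w :=
    by
    have h1 : _ = ((_ : L.verts) : ℕ) := congrArg Subtype.val p.getVert_length
    exact Subtype.ext h1
  rw [heq] at hlast
  exact hlast.trans (by exact_mod_cast hps)

/-- Proofs and vertices depend on the graph; an arbitrary predicate `F` lets all three be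
transported at once. -/
theorem eq_induce_of_eq_verts {L : LabelledGraph} (p : L.Proof) (v : L.verts) {S : Finset ℕ}
    (hS : S = L.verts) (i : S → L.verts) (hi : ∀ w, (i w : ℕ) = w) (hv : (v : ℕ) ∈ S)
    (F : ∀ L : LabelledGraph, L.Proof → L.verts → Prop) :
    F ⟨S, L.graph.comap i⟩ (fun w => p (i w)) ⟨v, hv⟩ ↔ F L p v := by
  subst hS
  obtain rfl : i = id := funext fun w => Subtype.ext (hi w)
  rfl

/-- The ball around the centre of a ball is the ball itself. -/
theorem ball_ball_iff (L : LabelledGraph) (p : L.Proof) (v : L.verts) (r : ℕ)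
    (F : ∀ L : LabelledGraph, L.Proof → L.verts → Prop) :
    F ((L.ball v r).ball (L.ballCentre v r) r)
      ((L.ball v r).ballProof (L.ballProof p v r) (L.ballCentre v r) r)
      ((L.ball v r).ballCentre (L.ballCentre v r) r) ↔
    F (L.ball v r) (L.ballProof p v r) (L.ballCentre v r) := by
  refine eq_induce_of_eq_verts (L := L.ball v r) (L.ballProof p v r) (L.ballCentre v r) ?_
    ((L.ball v r).ballIncl (L.ballCentre v r) r) (fun _ => rfl) _ F
  refine ((L.ball v r).ballVerts_subset _ _).antisymm fun w hw => ?_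
  have h1 := edist_ballCentre_le L v le_rfl ⟨w, hw⟩ ((mem_ballVerts _).1 hw)
  exact (mem_ballVerts (L := L.ball v r) ⟨w, hw⟩).2 h1

end LabelledGraph

/-! ### The local test and what it guarantees. -/

open scoped Classical in
/-- The verifier that applies a test to the ball of radius `r`. -/
noncomputable def Verifier.ofBall (F : ∀ L : LabelledGraph, L.Proof → L.verts → Prop) (r : ℕ) :
    Verifier :=
  fun L p v => decide (F (L.ball v r) (L.ballProof p v r) (L.ballCentre v r))

theorem Verifier.ofBall_hasHorizon (F : ∀ L : LabelledGraph, L.Proof → L.verts → Prop) (r : ℕ) :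
    (Verifier.ofBall F r).HasHorizon r := fun L p v => by
  simp only [Verifier.ofBall, decide_eq_decide]
  exact (L.ball_ball_iff p v r F).symm

/-- The local test: the certificates are decoded to colours `dec _ i`, one for each `i`. Each edge
at `v` is bichromatic for less than a fraction `ε` of the indices, and for each index the
monochromatic component of `v` belongs to `C` and stays within distance `D` of `v`. -/
def ColouringTest {I T : Type} (C : GraphClass) (ε : ℝ) (D : ℕ) (dec : List Bool → I → T)
    (L : LabelledGraph) (p : L.Proof) (v : L.verts) : Prop :=
  (∀ w, L.graph.Adj v w → ({i | dec (p v) i ≠ dec (p w) i}.ncard : ℝ) < ε * Nat.card I) ∧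
  ∀ i, (∀ w, (L.graph.monochromatic fun u => dec (p u) i).Reachable v w →
      L.graph.edist v w ≤ D) ∧
    C {w // (L.graph.monochromatic fun u => dec (p u) i).Reachable v w}
      (SimpleGraph.comap Subtype.val (L.graph.monochromatic fun u => dec (p u) i))

section Test

variable {I T : Type} {C : GraphClass} {ε : ℝ} {D : ℕ} {dec : List Bool → I → T}
  {L : LabelledGraph} {p : L.Proof} {v : L.verts}

theorem colouringTest_ball_of_forall (hmono : C.IsMonotone) (hC : C L.verts L.graph)
    (h1 : ∀ u w, L.graph.Adj u w →
      ({i | dec (p u) i ≠ dec (p w) i}.ncard : ℝ) < ε * Nat.card I)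
    (h2 : ∀ i u w, (L.graph.monochromatic fun u => dec (p u) i).Reachable u w →
      L.graph.edist u w ≤ D) :
    ColouringTest C ε D dec (L.ball v (D + 1)) (L.ballProof p v (D + 1))
      (L.ballCentre v (D + 1)) := by
  refine ⟨fun w hw => h1 v (L.ballIncl v (D + 1) w) hw, fun i => ⟨fun w hw => ?_, ?_⟩⟩
  · refine L.edist_ballCentre_le v (Nat.le_succ D) w (h2 i _ _ ?_)
    let f : ((L.ball v (D + 1)).graph.monochromatic
        fun u => dec (L.ballProof p v (D + 1) u) i) →g
        (L.graph.monochromatic fun u => dec (p u) i) :=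
      ⟨L.ballIncl v (D + 1), fun {a b} hab => hab⟩
    exact hw.map f
  · refine hmono _ _ _ _ ⟨⟨⟨fun w => L.ballIncl v (D + 1) w.1, fun {a b} hab => hab.1⟩, ?_⟩⟩ hC
    intro a b hab
    exact Subtype.ext (Subtype.ext (congrArg (fun x : L.verts => (x : ℕ)) hab))

theorem ColouringTest.adj (h : ColouringTest C ε D dec (L.ball v (D + 1))
      (L.ballProof p v (D + 1)) (L.ballCentre v (D + 1))) (w : L.verts) (hw : L.graph.Adj v w) :
    ({i | dec (p v) i ≠ dec (p w) i}.ncard : ℝ) < ε * Nat.card I := by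
  have hmem : (w : ℕ) ∈ L.ballVerts v (D + 1) := by
    rw [LabelledGraph.mem_ballVerts, SimpleGraph.edist_eq_one_iff_adj.2 hw]
    exact_mod_cast Nat.le_add_left 1 D
  exact h.1 ⟨w, hmem⟩ hw

/-- The component seen in the ball stays within distance `D`, so the neighbours of its vertices are
still in the ball of radius `D + 1`. Hence it is the whole component in `L`. -/
theorem ColouringTest.component (hmono : C.IsMonotone)
    (h : ColouringTest C ε D dec (L.ball v (D + 1)) (L.ballProof p v (D + 1))
      (L.ballCentre v (D + 1))) (i : I) :
    C {w // (L.graph.monochromatic fun u => dec (p u) i).Reachable v w}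
      (SimpleGraph.comap Subtype.val (L.graph.monochromatic fun u => dec (p u) i)) := by
  obtain ⟨h1, h2⟩ := h.2 i
  let f : (L.ball v (D + 1)).graph →g L.graph := ⟨L.ballIncl v (D + 1), fun {a b} hab => hab⟩
  have key : ∀ w : L.verts, (L.graph.monochromatic fun u => dec (p u) i).Reachable v w →
      ∃ hw : (w : ℕ) ∈ L.ballVerts v (D + 1),
        ((L.ball v (D + 1)).graph.monochromatic
          fun u => dec (L.ballProof p v (D + 1) u) i).Reachable
          (L.ballCentre v (D + 1)) ⟨w, hw⟩ := by
    intro w hw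
    rw [SimpleGraph.reachable_iff_reflTransGen] at hw
    induction hw with
    | refl => exact ⟨L.self_mem_ballVerts v _, .rfl⟩
    | @tail a b _ hab ih =>
      obtain ⟨ha, hr⟩ := ih
      have hb : (b : ℕ) ∈ L.ballVerts v (D + 1) := by
        rw [LabelledGraph.mem_ballVerts]
        obtain ⟨q, hq⟩ := SimpleGraph.exists_walk_of_edist_ne_top
          (ne_top_of_le_ne_top (ENat.natCast_ne_top D) (h1 _ hr))
        have hqD : (q.length : ℕ∞) ≤ D := hq ▸ h1 _ hr
        have hva : L.graph.edist v a ≤ D := by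
          refine (SimpleGraph.edist_le (q.map f)).trans ?_
          rwa [SimpleGraph.Walk.length_map]
        refine (SimpleGraph.edist_triangle (v := a)).trans ?_
        rw [Nat.cast_succ]
        exact add_le_add hva (SimpleGraph.edist_eq_one_iff_adj.2 hab.1).le
      have hadj : ((L.ball v (D + 1)).graph.monochromatic
          fun u => dec (L.ballProof p v (D + 1) u) i).Adj ⟨a, ha⟩ ⟨b, hb⟩ := hab
      exact ⟨hb, hr.trans hadj.reachable⟩
  refine hmono _ _ _ _ ⟨⟨⟨fun w => ⟨⟨w.1, (key w.1 w.2).1⟩, (key w.1 w.2).2⟩,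
    fun {a b} hab => hab⟩, ?_⟩⟩ h2
  intro a b hab
  exact Subtype.ext (Subtype.ext (congrArg (fun x => ((x.1 : (L.ball v (D + 1)).verts) : ℕ)) hab))

end Test

/-! ### Constant-size certificates and the theorem. -/

/-- A finite type can be encoded by binary words of bounded length. -/
theorem exists_binary_encoding (T : Type) [Finite T] [Nonempty T] :
    ∃ (K : ℕ) (enc : T → List Bool) (dec : List Bool → T),
      (∀ t, dec (enc t) = t) ∧ ∀ t, (enc t).length ≤ K := by
  obtain ⟨n, ⟨e⟩⟩ := Finite.exists_equiv_fin T
  -- Unary words suffice, as the type does not depend on the graph.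
  have hinj : Function.Injective fun t : T => List.replicate (e t : ℕ) true := fun s t hst =>
    e.injective (Fin.ext (by simpa using congrArg List.length hst))
  exact ⟨n, _, _, Function.leftInverse_invFun hinj, fun t => by simp⟩

theorem theorem1p4 (𝒢 : GraphClass) (h𝒢 : 𝒢.IsProperMinorClosed)
    (P : GraphClass)
    (hP𝒢 : ∀ (V : Type) [Finite V] (G : SimpleGraph V), P V G → 𝒢 V G)
    (hmono : P.IsMonotone) (hsum : P.IsSummable)
    (ε : ℝ) (hε : 0 < ε) :
    ∃ r K : ℕ, ∀ q : Polynomial ℕ, P.HasApproxPLS q ε r K := by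
  classical
  obtain ⟨h, hh, hminor⟩ := h𝒢.exists_not_isMinor_top
  obtain ⟨I, T, _, _, _, _, D, hcol⟩ := SimpleGraph.exists_padded_colouring hh hε
  obtain ⟨K, enc, dec, hdec, hK⟩ := exists_binary_encoding (I → T)
  choose! c hc1 hc2 using hcol
  let Pr : Prover := fun L v => enc fun i => c L.verts L.graph i v
  refine ⟨D + 1, K, fun q => ⟨Pr, Verifier.ofBall (ColouringTest P ε D dec) (D + 1),
    ⟨⟨D + 1, le_rfl, Verifier.ofBall_hasHorizon _ _⟩, ?_, ?_⟩, fun L _ _ _ v => hK _⟩⟩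
  · intro L hL _ hPL v
    have hm := hminor _ _ (hP𝒢 _ _ hPL)
    refine decide_eq_true (colouringTest_ball_of_forall hmono hPL ?_ ?_)
    · simpa only [Pr, hdec] using hc1 _ _ hL hm
    · simp only [Pr, hdec]
      intro i u w huw
      rw [← (hL u w).coe_dist_eq_edist]
      exact_mod_cast hc2 _ _ hL hm i u w huw
  · intro L hL _ hfar p
    by_contra! hacc
    have htest : ∀ v, ColouringTest P ε D dec (L.ball v (D + 1)) (L.ballProof p v (D + 1))
        (L.ballCentre v (D + 1)) := fun v => by
      simpa [Verifier.ofBall] using hacc v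
    have := hL.nonempty
    have hP : ∀ i, P L.verts (L.graph.monochromatic fun u => dec (p u) i) := by
      refine fun i => GraphClass.of_connectedComponents hmono hsum fun Q => ?_
      induction Q using SimpleGraph.ConnectedComponent.ind with
      | _ v =>
        refine hmono _ _ _ _ ⟨⟨⟨fun w => ⟨w.1,
          (SimpleGraph.ConnectedComponent.exact w.2).symm⟩, fun {a b} hab => hab⟩, ?_⟩⟩
          ((htest v).component hmono i)
        intro a b hab
        exact Subtype.ext (congrArg (fun x => (x.1 : L.verts)) hab)
    -- Averaging needs an edge. Without edges the monochromatic subgraph is the graph itself, and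
    -- membership contradicts the first clause of `IsFar`.
    rcases L.graph.edgeSet.eq_empty_or_nonempty with hE | hE
    · refine hfar.1 ?_
      have hbot := SimpleGraph.edgeSet_eq_empty.1 hE
      have h1 := hP (Classical.arbitrary I)
      rwa [le_bot_iff.1 ((L.graph.monochromatic_le _).trans hbot.le), ← hbot] at h1
    · obtain ⟨i, hi⟩ := SimpleGraph.exists_ncard_symmDiff_monochromatic_lt hE
        (fun i u => dec (p u) i) fun u w huw => (htest u).adj w huw
      exact (hfar.2 _ (hP i)).not_gt hi
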